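/- All graphs are finite, simple and undirected. For a set $L$ of integers $\ge 3$, an $L$-cycle graph is a graph in which the length (number of edges) of every cycle belongs to $L$, and $c(L,n)$ denotes the maximum number of cycles (counted as subgraphs) in an $L$-cycle graph on $n$ vertices. Let $n\ge 1$. (a) If $L$ is a (finite or infinite) set of odd integers with smallest element $2k+1>1$, then \[c(L,n)=\left\lfloor \frac{n-1}{2k}\right\rfloor .\] In particular, $c(\{2k+1\},n)=\left\lfloor \frac{n-1}{2k}\right\rfloor$ for every $k\ge 1$. (b) If $L$ consists of a single even integer $2k\ge 4$, then \[c(\{2k\},n)=\binom{\left\lfloor \frac{n-2}{k-1}\right\rfloor}{2},\] where for $n=1$ the floor is read as $0$ (so that $c(\{2k\},1)=0$). -/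

import Mathlib

/-- `G` is an `L`-cycle graph: the length of every cycle of `G` belongs to `L`. -/
def IsLCycleGraph {V : Type*} (L : Set ℕ) (G : SimpleGraph V) : Prop :=
  ∀ (v : V) (p : G.Walk v v), p.IsCycle → p.length ∈ L

/-- The cycles of `G`, as subgraphs: closed walks which are cycles and differ only in the starting
vertex or in the direction of traversal trace out the same cycle. -/
def cyclesOf {V : Type*} (G : SimpleGraph V) : Set G.Subgraph :=
  {H | ∃ (v : V) (p : G.Walk v v), p.IsCycle ∧ p.toSubgraph = H}

/-- The number of cycles of `G` (used for finite graphs). -/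
noncomputable def numCycles {V : Type*} (G : SimpleGraph V) : ℕ := (cyclesOf G).ncard

/-- `c(L, n)`: the maximum number of cycles in an `L`-cycle graph with `n` vertices. -/
noncomputable def maxCycles (L : Set ℕ) (n : ℕ) : ℕ :=
  sSup {m | ∃ G : SimpleGraph (Fin n), IsLCycleGraph L G ∧ numCycles G = m}

/-- The supremum that defines `maxCycles L n` is an attained maximum. -/
theorem isGreatest_maxCycles (L : Set ℕ) (n : ℕ) :
    IsGreatest {m | ∃ G : SimpleGraph (Fin n), IsLCycleGraph L G ∧ numCycles G = m}
      (maxCycles L n) := by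
  have hfin : {m | ∃ G : SimpleGraph (Fin n), IsLCycleGraph L G ∧ numCycles G = m}.Finite :=
    (Set.finite_range (fun G : SimpleGraph (Fin n) => numCycles G)).subset
      (by rintro m ⟨G, -, rfl⟩; exact ⟨G, rfl⟩)
  have hne : {m | ∃ G : SimpleGraph (Fin n), IsLCycleGraph L G ∧ numCycles G = m}.Nonempty := by
    refine ⟨_, ⊥, ?_, rfl⟩
    intro v p hp
    cases p with
    | nil => exact absurd rfl hp.ne_nil
    | cons h q => exact absurd h (by simp)
  exact ⟨Nat.sSup_mem hne hfin.bddAbove, fun m hm => le_csSup hfin.bddAbove hm⟩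

/-
Upper bounds. Suppose that all paths from `u` to `v` are internally disjoint, and that there are
`m` of them. A cycle that shares an edge with one of these paths is the union of two of them, so
deleting all their edges destroys at most `m.choose 2` cycles. Moreover no two vertices on these
paths remain connected, so the number of components grows by at least the number of these vertices
minus one, and induction on the graph applies. If the graph contains no theta graph, the ends of any
edge of a cycle are such a pair, with `m = 2`; this is always so if all cycles are odd, since of
three paths with the same ends two have lengths of equal parity. If all cycles have length `2k`, the
three paths of a theta graph have length `k`, and comparing lengths shows that every further path
with the same ends is internally disjoint from them, so that all paths between the ends are
internally disjoint.

Lower bounds. Paths are glued together at their ends, either to cycles of length `2k + 1` through a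
common vertex, or to a generalized theta graph of paths of length `k`.
-/

namespace LCycleGraph

open SimpleGraph SimpleGraph.Walk

section Walks

variable {V : Type*} {G : SimpleGraph V} {u v w x y : V}

theorem exists_append_first_mem (p : G.Walk u v) {S : Set V} (hv : v ∈ S) :
    ∃ (y : V) (q : G.Walk u y) (r : G.Walk y v), y ∈ S ∧ p = q.append r ∧
      ∀ w ∈ q.support, w ∈ S → w = y := by
  induction p with
  | nil => exact ⟨_, nil, nil, hv, rfl, by simp⟩
  | @cons a _ _ h p ih =>
    by_cases ha : a ∈ S
    · exact ⟨a, nil, cons h p, ha, rfl, by simp⟩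
    · obtain ⟨y, q, r, hy, rfl, hq⟩ := ih hv
      refine ⟨y, cons h q, r, hy, rfl, fun w hw hwS => ?_⟩
      rcases List.mem_cons.1 (support_cons h q ▸ hw) with rfl | hw
      · exact absurd hwS ha
      · exact hq w hw hwS

theorem exists_append_last_mem (p : G.Walk u v) {S : Set V} (hu : u ∈ S) :
    ∃ (y : V) (q : G.Walk u y) (r : G.Walk y v), y ∈ S ∧ p = q.append r ∧
      ∀ w ∈ r.support, w ∈ S → w = y := by
  obtain ⟨y, q, r, hy, h, hq⟩ := exists_append_first_mem p.reverse hu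
  refine ⟨y, r.reverse, q.reverse, hy, ?_, by simpa using hq⟩
  rw [← reverse_append, ← h, reverse_reverse]

theorem append_right_injective (p : G.Walk u v) :
    Function.Injective (p.append : G.Walk v w → G.Walk u w) := by
  intro q r h
  induction p with
  | nil => exact h
  | cons _ p ih =>
    injection h with _ _ _ h
    exact ih h

theorem append_left_injective (p : G.Walk v w) :
    Function.Injective fun q : G.Walk u v => q.append p := by
  intro q r h
  refine reverse_injective (append_right_injective p.reverse ?_)
  simpa only [reverse_append] using congrArg Walk.reverse h

theorem isPath_append {p : G.Walk u v} {q : G.Walk v w} (hp : p.IsPath) (hq : q.IsPath)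
    (h : ∀ x ∈ p.support, x ∈ q.support → x = v) : (p.append q).IsPath := by
  rw [isPath_def, support_append, List.nodup_append']
  refine ⟨hp.support_nodup, hq.support_nodup.tail, fun x hx hx' => ?_⟩
  obtain rfl := h x hx (List.mem_of_mem_tail hx')
  have hnodup := hq.support_nodup
  rw [← cons_tail_support, List.nodup_cons] at hnodup
  exact hnodup.1 hx'

theorem eq_of_isPath_append {p : G.Walk u v} {q : G.Walk v w} (h : (p.append q).IsPath)
    (hp : x ∈ p.support) (hq : x ∈ q.support) : x = v := by
  by_contra hne
  exact h.ne_of_mem_support_of_append hne hp hq rfl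

theorem isPath_append_append_of_forall {a : G.Walk u x} {m n : G.Walk x y} {b : G.Walk y v}
    (hp : (a.append (m.append b)).IsPath) (hn : n.IsPath)
    (hnp : ∀ w ∈ n.support, w ∈ (a.append (m.append b)).support → w = x ∨ w = y) :
    (a.append (n.append b)).IsPath := by
  have hx : ∀ w ∈ a.support, w ∈ (m.append b).support → w = x :=
    fun w => eq_of_isPath_append hp
  have hy : ∀ w ∈ m.support, w ∈ b.support → w = y :=
    fun w => eq_of_isPath_append hp.of_append_right
  have hxm := m.start_mem_support
  have hym := m.end_mem_support
  refine isPath_append hp.of_append_left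
    (isPath_append hn hp.of_append_right.of_append_right ?_) ?_ <;>
  grind [mem_support_append_iff]

/-- Two walks with the same ends are internally disjoint if they share no vertex but the ends. -/
def InternallyDisjoint (p q : G.Walk u v) : Prop :=
  ∀ w, w ∈ p.support → w ∈ q.support → w = u ∨ w = v

theorem InternallyDisjoint.symm {p q : G.Walk u v} (h : InternallyDisjoint p q) :
    InternallyDisjoint q p := fun w hq hp => h w hp hq

/-- Two distinct internally disjoint paths with the same ends, that is, a cycle cut at two of its
vertices. -/
structure IsBigon (p q : G.Walk u v) : Prop where
  isPath_left : p.IsPath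
  isPath_right : q.IsPath
  ne : p ≠ q
  internallyDisjoint : InternallyDisjoint p q

theorem IsBigon.symm {p q : G.Walk u v} (h : IsBigon p q) : IsBigon q p :=
  ⟨h.isPath_right, h.isPath_left, h.ne.symm, h.internallyDisjoint.symm⟩

theorem IsBigon.ends_ne {p q : G.Walk u v} (h : IsBigon p q) : u ≠ v := by
  rintro rfl
  exact h.ne ((isPath_iff_nil.1 h.isPath_left).eq_nil.trans
    (isPath_iff_nil.1 h.isPath_right).eq_nil.symm)

theorem IsBigon.isCycle {p q : G.Walk u v} (h : IsBigon p q) : (p.append q.reverse).IsCycle := by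
  refine h.isPath_left.isCycle_append h.isPath_right.reverse (fun w hwp hwq => ?_) ?_
  · have hp := h.isPath_left.support_nodup
    have hq := h.isPath_right.reverse.support_nodup
    rw [← cons_tail_support, List.nodup_cons] at hp hq
    rcases h.internallyDisjoint w (List.mem_of_mem_tail hwp)
      (by simpa using List.mem_of_mem_tail hwq) with rfl | rfl
    · exact hp.1 hwp
    · exact hq.1 hwq
  · grind [length_reverse, eq_of_length_le_one, h.ne]

theorem IsBigon.length_add_length_mem {L : Set ℕ} (hG : IsLCycleGraph L G) {p q : G.Walk u v}
    (h : IsBigon p q) : p.length + q.length ∈ L := by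
  simpa only [length_append, length_reverse] using hG _ _ h.isCycle

theorem exists_ear {p q : G.Walk u v} (hp : p.IsPath) (hq : q.IsPath) (hne : p ≠ q) :
    ∃ (x y : V) (a : G.Walk u x) (m n : G.Walk x y) (b b' : G.Walk y v),
      p = a.append (m.append b) ∧ q = a.append (n.append b') ∧ IsBigon m n ∧
      ∀ w ∈ n.support, w ∈ p.support → w = x ∨ w = y := by
  induction p with
  | nil => exact absurd (isPath_iff_nil.1 hq).eq_nil.symm hne
  | @cons u s v h p ih =>
    cases q with
    | nil => exact absurd (isPath_iff_nil.1 hp).eq_nil hne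
    | @cons _ t _ h' q =>
      obtain ⟨hp', hup⟩ := (cons_isPath_iff h p).1 hp
      obtain ⟨hq', huq⟩ := (cons_isPath_iff h' q).1 hq
      by_cases hst : s = t
      · subst hst
        obtain ⟨x, y, a, m, n, b, b', rfl, rfl, hmn, hn⟩ := ih hp' hq' fun h => hne (by rw [h])
        refine ⟨x, y, cons h a, m, n, b, b', rfl, rfl, hmn, fun w hw hwp => ?_⟩
        rcases List.mem_cons.1 hwp with rfl | hwp
        · exact absurd (by simp [mem_support_append_iff, hw]) huq
        · exact hn w hw hwp
      · obtain ⟨y, n, r, hy, rfl, hn⟩ :=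
          exists_append_first_mem q (S := {w | w ∈ (cons h p).support}) (end_mem_support _)
        obtain ⟨m, b, hmb⟩ := Walk.mem_support_iff_exists_append.1 hy
        have hear : ∀ w ∈ (cons h' n).support, w ∈ (cons h p).support → w = u ∨ w = y :=
          fun w hw hwp => (List.mem_cons.1 hw).imp_right fun hw => hn w hw hwp
        refine ⟨u, y, nil, m, cons h' n, b, r, hmb, rfl, ⟨?_, ?_, ?_, ?_⟩, hear⟩
        · exact (hmb ▸ hp).of_append_left
        · exact IsPath.of_append_left (p := cons h' n) hq
        · rintro rfl
          injection hmb with _ hst'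
          exact hst hst'
        · exact fun w hwm hwn => hear w hwn (by rw [hmb]; simp [mem_support_append_iff, hwm])

theorem isBigon_of_isCycle_append {p : G.Walk x y} {q : G.Walk y x} (h : (p.append q).IsCycle)
    (hxy : x ≠ y) : IsBigon p q.reverse := by
  have hp : ¬ p.Nil := fun h => hxy h.eq
  have hq : ¬ q.Nil := fun h => hxy h.eq.symm
  refine ⟨h.isPath_of_append_left hq, (h.isPath_of_append_right hp).reverse, ?_,
    fun w hwp hwq => ?_⟩
  · rintro rfl
    have hdisj := ((isTrail_append _ _).1 h.isTrail).2.2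
    rw [edges_reverse, List.disjoint_comm] at hdisj
    cases q with
    | nil => exact hq Nil.nil
    | cons h q => exact hdisj List.mem_cons_self (by simp)
  · have hdisj := h.support_nodup
    rw [tail_support_append, List.nodup_append'] at hdisj
    rw [support_reverse, List.mem_reverse, mem_support_iff] at hwq
    rw [mem_support_iff] at hwp
    exact hwp.imp_right fun hwp => hwq.resolve_right fun hwq => hdisj.2.2 hwp hwq

theorem exists_isBigon_of_isCycle {z : V} {c : G.Walk z z} (hc : c.IsCycle) (hx : x ∈ c.support)
    (hy : y ∈ c.support) (hxy : x ≠ y) :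
    ∃ p q : G.Walk x y, IsBigon p q ∧ c.toSubgraph = p.toSubgraph ⊔ q.toSubgraph := by
  classical
  obtain ⟨p, q, hpq⟩ :=
    Walk.mem_support_iff_exists_append.1 ((mem_support_rotate_iff c x hx).2 hy)
  refine ⟨p, q.reverse, isBigon_of_isCycle_append (hpq ▸ (isCycle_rotate hx).2 hc) hxy, ?_⟩
  rw [← toSubgraph_rotate c hx, hpq, toSubgraph_append, toSubgraph_reverse]

theorem exists_append_append_mem {p : G.Walk u v} (hp : p.IsPath) {S : Set V} {s t : V}
    (hsp : s ∈ p.support) (htp : t ∈ p.support) (hs : s ∈ S) (ht : t ∈ S) (hst : s ≠ t) :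
    ∃ (x y : V) (a : G.Walk u x) (m : G.Walk x y) (b : G.Walk y v),
      p = a.append (m.append b) ∧ x ∈ S ∧ y ∈ S ∧ x ≠ y ∧
      (∀ w ∈ a.support, w ∈ S → w = x) ∧ ∀ w ∈ b.support, w ∈ S → w = y := by
  obtain ⟨p₁, p₂, rfl⟩ := Walk.mem_support_iff_exists_append.1 hsp
  obtain ⟨x, a, m₁, hx, rfl, ha⟩ := exists_append_first_mem p₁ hs
  obtain ⟨y, m₂, b, hy, rfl, hb⟩ := exists_append_last_mem p₂ hs
  refine ⟨x, y, a, m₁.append m₂, b, by simp only [append_assoc], hx, hy, ?_, ha, hb⟩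
  rintro rfl
  have hm : (m₁.append m₂).IsPath := by
    rw [← append_assoc, append_assoc m₁] at hp
    exact hp.of_append_right.of_append_left
  have hnil : (m₁.append m₂).support = [x] := by
    rw [(isPath_iff_nil.1 hm).eq_nil, support_nil]
  have hS : ∀ w ∈ ((a.append m₁).append (m₂.append b)).support, w ∈ S → w = x := by
    intro w hw hwS
    have hw' : w ∈ a.support ∨ w ∈ (m₁.append m₂).support ∨ w ∈ b.support := by
      grind [mem_support_append_iff]
    rcases hw' with hw | hw | hw
    · exact ha w hw hwS
    · simpa [hnil] using hw
    · exact hb w hw hwS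
  exact hst ((hS s hsp hs).trans (hS t htp ht).symm)

/-- All paths from `u` to `v` are internally disjoint. The graph is shrunk by deleting the edges of
all these paths for a suitable such pair of vertices. -/
def PathsDisjoint (G : SimpleGraph V) (u v : V) : Prop :=
  ∀ p q : G.Walk u v, p.IsPath → q.IsPath → p ≠ q → InternallyDisjoint p q

/-- A cycle sharing an edge with a `u`-`v` path cuts a segment `x`-`y` out of it, and rerouting the
path along either arc of the cycle gives two `u`-`v` paths. As these are internally disjoint,
`x = u` and `y = v`. -/
theorem PathsDisjoint.exists_isBigon_toSubgraph_eq (h : PathsDisjoint G u v) {z : V}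
    {c : G.Walk z z} (hc : c.IsCycle) {p : G.Walk u v} (hp : p.IsPath) {e : Sym2 V}
    (hep : e ∈ p.edges) (hec : e ∈ c.edges) :
    ∃ q r : G.Walk u v, IsBigon q r ∧ c.toSubgraph = q.toSubgraph ⊔ r.toSubgraph := by
  induction e using Sym2.ind with | _ s t
  obtain ⟨x, y, a, m, b, rfl, hx, hy, hxy, ha, hb⟩ :=
    exists_append_append_mem hp (S := {w | w ∈ c.support}) (p.fst_mem_support_of_mem_edges hep)
      (p.snd_mem_support_of_mem_edges hep) (c.fst_mem_support_of_mem_edges hec)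
      (c.snd_mem_support_of_mem_edges hec) (p.adj_of_mem_edges hep).ne
  obtain ⟨d₁, d₂, hd, hsub⟩ := exists_isBigon_of_isCycle hc hx hy hxy
  have hd_mem : ∀ w, w ∈ d₁.support ∨ w ∈ d₂.support → w ∈ c.support := by
    intro w hw
    rw [← mem_verts_toSubgraph, hsub, Subgraph.verts_sup]
    simpa only [Set.mem_union, mem_verts_toSubgraph] using hw
  have hreroute : ∀ d : G.Walk x y, d.IsPath → (∀ w ∈ d.support, w ∈ c.support) →
      (a.append (d.append b)).IsPath := by
    intro d hdp hdc
    have hab : ∀ w ∈ a.support, w ∈ b.support → w = x := fun w hwa hwb =>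
      eq_of_isPath_append hp hwa (by simp [mem_support_append_iff, hwb])
    refine isPath_append hp.of_append_left
      (isPath_append hdp hp.of_append_right.of_append_right fun w hw hwb => hb w hwb (hdc w hw))
      fun w hwa hw => ?_
    rcases (mem_support_append_iff _ _).1 hw with hw | hw
    · exact ha w hwa (hdc w hw)
    · exact hab w hwa hw
  have hpath₁ := hreroute d₁ hd.isPath_left fun w hw => hd_mem w (Or.inl hw)
  have hpath₂ := hreroute d₂ hd.isPath_right fun w hw => hd_mem w (Or.inr hw)
  have hends := h _ _ hpath₁ hpath₂
    fun heq => hd.ne (append_left_injective b (append_right_injective a heq))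
  obtain rfl : x = u := (hends x (by simp) (by simp)).resolve_right fun hxv =>
    hxy (eq_of_isPath_append hpath₁.of_append_right d₁.start_mem_support
      (hxv ▸ b.end_mem_support))
  obtain rfl : y = v := (hends y (by simp) (by simp)).resolve_left hxy.symm
  exact ⟨d₁, d₂, hd, hsub⟩

end Walks

section Theta

variable {V : Type*} {G : SimpleGraph V} {u v w x y z : V} {k : ℕ}

/-- A theta graph: three paths with the same ends, any two of which form a cycle. -/
structure IsTheta (p q r : G.Walk u v) : Prop where
  bigon₁₂ : IsBigon p q
  bigon₁₃ : IsBigon p r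
  bigon₂₃ : IsBigon q r

theorem IsTheta.rotate {p q r : G.Walk u v} (h : IsTheta p q r) : IsTheta q r p :=
  ⟨h.bigon₂₃, h.bigon₁₂.symm, h.bigon₁₃.symm⟩

theorem IsTheta.swap {p q r : G.Walk u v} (h : IsTheta p q r) : IsTheta p r q :=
  ⟨h.bigon₁₃, h.bigon₁₂, h.bigon₂₃.symm⟩

theorem not_isTheta_of_forall_odd {L : Set ℕ} (hL : ∀ m ∈ L, Odd m) (hG : IsLCycleGraph L G)
    (p q r : G.Walk u v) : ¬ IsTheta p q r := by
  intro h
  have h₁₂ := hL _ (h.bigon₁₂.length_add_length_mem hG)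
  have h₁₃ := hL _ (h.bigon₁₃.length_add_length_mem hG)
  have h₂₃ := hL _ (h.bigon₂₃.length_add_length_mem hG)
  grind

theorem IsBigon.length_add_length (hG : IsLCycleGraph {2 * k} G) {p q : G.Walk u v}
    (h : IsBigon p q) : p.length + q.length = 2 * k :=
  h.length_add_length_mem hG

theorem IsTheta.length_eq (hG : IsLCycleGraph {2 * k} G) {p q r : G.Walk u v}
    (h : IsTheta p q r) : p.length = k := by
  have h₁₂ := h.bigon₁₂.length_add_length hG
  have h₁₃ := h.bigon₁₃.length_add_length hG
  have h₂₃ := h.bigon₂₃.length_add_length hG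
  lia

/-- The lengths of the rerouted path and of the ear show that both equal `k`, so nothing of the
old path remains. -/
theorem IsTheta.ends_eq_of_isBigon (hG : IsLCycleGraph {2 * k} G) {a : G.Walk u x}
    {m n : G.Walk x y} {b : G.Walk y v} {q r : G.Walk u v}
    (h : IsTheta (a.append (m.append b)) q r) (hmn : IsBigon m n)
    (hn : ∀ w ∈ n.support, w ∈ (a.append (m.append b)).support → w = x ∨ w = y)
    (hnq : ∀ w ∈ n.support, w ∈ q.support → w ∈ (a.append (m.append b)).support) :
    u = x ∧ y = v := by
  have hpath := isPath_append_append_of_forall h.bigon₁₂.isPath_left hmn.isPath_right hn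
  have hdisj : InternallyDisjoint (a.append (n.append b)) q := by
    intro w hw hwq
    refine h.bigon₁₂.internallyDisjoint w ?_ hwq
    grind [mem_support_append_iff]
  have hq := h.rotate.length_eq hG
  have hlen : (a.append (n.append b)).length = k := by
    by_cases heq : a.append (n.append b) = q
    · rw [heq, hq]
    · have := IsBigon.length_add_length hG ⟨hpath, h.bigon₁₂.isPath_right, heq, hdisj⟩
      lia
  have hp := h.length_eq hG
  have hcycle := hmn.length_add_length hG
  simp only [length_append] at hlen hp
  exact ⟨eq_of_length_eq_zero (p := a) (by lia), eq_of_length_eq_zero (p := b) (by lia)⟩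

theorem IsTheta.length_add_length_of_cross (hG : IsLCycleGraph {2 * k} G) {p : G.Walk u v}
    {a : G.Walk u z} {a' : G.Walk z v} {b : G.Walk u w} {b' : G.Walk w v} {s : G.Walk z w}
    (h : IsTheta p (a.append a') (b.append b')) (hs : s.IsPath)
    (hsp : ∀ t ∈ s.support, t ∉ p.support) (hsa : ∀ t ∈ s.support, t ∈ a.support → t = z)
    (hsb : ∀ t ∈ s.support, t ∈ b'.support → t = w) :
    a.length + s.length + b'.length = k := by
  have hva : v ∉ a.support := fun hv => hsp z s.start_mem_support
    (eq_of_isPath_append h.bigon₂₃.isPath_left hv a'.end_mem_support ▸ p.end_mem_support)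
  have hub : u ∉ b'.support := fun hu => hsp w s.end_mem_support
    (eq_of_isPath_append h.bigon₂₃.isPath_right b.start_mem_support hu ▸ p.start_mem_support)
  have hab := h.bigon₂₃.internallyDisjoint
  have hpath : (a.append (s.append b')).IsPath := by
    refine isPath_append h.bigon₂₃.isPath_left.of_append_left
      (isPath_append hs h.bigon₂₃.isPath_right.of_append_right hsb) fun t hta ht => ?_
    rcases (mem_support_append_iff _ _).1 ht with ht | ht
    · exact hsa t ht hta
    · rcases hab t (by simp [mem_support_append_iff, hta])
        (by simp [mem_support_append_iff, ht]) with rfl | rfl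
      · exact absurd ht hub
      · exact absurd hta hva
  have hdisj : InternallyDisjoint (a.append (s.append b')) p := by
    intro t ht htp
    have h₁₂ := h.bigon₁₂.internallyDisjoint t htp
    have h₁₃ := h.bigon₁₃.internallyDisjoint t htp
    grind [mem_support_append_iff]
  have hne : a.append (s.append b') ≠ p := fun heq => hsp z s.start_mem_support (heq ▸ by simp)
  have hlen := IsBigon.length_add_length hG ⟨hpath, h.bigon₁₂.isPath_left, hne, hdisj⟩
  have hp := h.length_eq hG
  simp only [length_append] at hlen
  lia

theorem IsTheta.exists_mem_of_cross (hG : IsLCycleGraph {2 * k} G) {p q r : G.Walk u v}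
    (h : IsTheta p q r) {s : G.Walk z w} (hs : s.IsPath) (hz : z ∈ q.support)
    (hw : w ∈ r.support) : ∃ t ∈ s.support, t ∈ p.support := by
  by_contra! hsp
  obtain ⟨w, s', s₂, hw, rfl, hsr⟩ := exists_append_first_mem s (S := {t | t ∈ r.support}) hw
  obtain ⟨z, s₁, s, hz, rfl, hsq⟩ := exists_append_last_mem s' (S := {t | t ∈ q.support}) hz
  replace hs := hs.of_append_left.of_append_right
  replace hsp : ∀ t ∈ s.support, t ∉ p.support := fun t ht => hsp t (by simp [ht])
  replace hsr : ∀ t ∈ s.support, t ∈ r.support → t = w := fun t ht => hsr t (by simp [ht])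
  obtain ⟨a, a', rfl⟩ := Walk.mem_support_iff_exists_append.1 hz
  obtain ⟨b, b', rfl⟩ := Walk.mem_support_iff_exists_append.1 hw
  have hqr := h.length_add_length_of_cross hG hs hsp (fun t ht hta => hsq t ht (by simp [hta]))
    fun t ht htb => hsr t ht (by simp [htb])
  have hrq := h.swap.length_add_length_of_cross hG hs.reverse (by simpa using hsp)
    (fun t ht htb => hsr t (by simpa using ht) (by simp [htb]))
    fun t ht hta => hsq t (by simpa using ht) (by simp [hta])
  have hq := h.rotate.length_eq hG
  have hr := h.rotate.rotate.length_eq hG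
  rw [length_append] at hq hr
  rw [length_reverse] at hrq
  obtain rfl : z = w := eq_of_length_eq_zero (p := s) (by lia)
  rcases h.bigon₂₃.internallyDisjoint z hz hw with rfl | rfl
  · exact hsp z (by simp) (by simp)
  · exact hsp z (by simp) (by simp)

theorem exists_isPath_of_mem_support {n : G.Walk x y} (hn : n.IsPath) (hz : z ∈ n.support)
    (hw : w ∈ n.support) (hzx : z ≠ x) (hzy : z ≠ y) (hwx : w ≠ x) (hwy : w ≠ y) :
    ∃ s : G.Walk z w, s.IsPath ∧ ∀ t ∈ s.support, t ∈ n.support ∧ t ≠ x ∧ t ≠ y := by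
  classical
  cases n with
  | nil => exact absurd (by simpa using hz) hzx
  | @cons _ c _ h n =>
    rw [cons_isPath_iff] at hn
    replace hz : z ∈ n.support := (List.mem_cons.1 hz).resolve_left hzx
    replace hw : w ∈ n.support := (List.mem_cons.1 hw).resolve_left hwx
    have hinterior : ∀ (t : V) (ht : t ∈ n.support), t ≠ y →
        ∀ t' ∈ (n.takeUntil t ht).support, t' ∈ (cons h n).support ∧ t' ≠ x ∧ t' ≠ y := by
      intro t ht hty t' ht'
      have ht'n := n.support_takeUntil_subset_support ht ht'
      refine ⟨List.mem_cons_of_mem _ ht'n, ne_of_mem_of_not_mem ht'n hn.2, ?_⟩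
      rintro rfl
      exact endpoint_notMem_support_takeUntil hn.1 ht hty.symm ht'
    refine ⟨((n.takeUntil z hz).reverse.append (n.takeUntil w hw)).bypass, bypass_isPath _,
      fun t ht => ?_⟩
    rcases (mem_support_append_iff _ _).1 (support_bypass_subset_support _ ht) with ht | ht
    · exact hinterior z hz hzy t (by simpa using ht)
    · exact hinterior w hw hwy t ht

/-- An ear of `p` cut out by `s` must meet both other paths of the theta graph off `p`, as
otherwise its ends are `u` and `v`; it then contains a crossing of these two that avoids `p`. -/
theorem IsTheta.internallyDisjoint (hG : IsLCycleGraph {2 * k} G) {p q r s : G.Walk u v}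
    (h : IsTheta p q r) (hs : s.IsPath) (hne : p ≠ s) : InternallyDisjoint p s := by
  obtain ⟨x, y, a, m, n, b, b', rfl, rfl, hmn, hn⟩ := exists_ear h.bigon₁₂.isPath_left hs hne
  by_cases hends : u = x ∧ y = v
  · obtain ⟨rfl, rfl⟩ := hends
    have hb' := (isPath_iff_nil.1 hs.of_append_right.of_append_right).eq_nil
    have ha := (isPath_iff_nil.1 hs.of_append_left).eq_nil
    subst hb' ha
    exact fun w hwp hwn => hn w (by simpa using hwn) hwp
  have hmeets : ∀ q r : G.Walk u v, IsTheta (a.append (m.append b)) q r →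
      ∃ t ∈ n.support, t ∈ q.support ∧ t ∉ (a.append (m.append b)).support := by
    intro q r h
    by_contra! hnq
    exact hends (h.ends_eq_of_isBigon hG hmn hn hnq)
  obtain ⟨z, hzn, hzq, hzp⟩ := hmeets q r h
  obtain ⟨w, hwn, hwr, hwp⟩ := hmeets r q h.swap
  have hxp : x ∈ (a.append (m.append b)).support := by simp
  have hyp : y ∈ (a.append (m.append b)).support := by simp
  obtain ⟨c, hc, hcn⟩ := exists_isPath_of_mem_support hmn.isPath_right hzn hwn
    (ne_of_mem_of_not_mem hxp hzp).symm (ne_of_mem_of_not_mem hyp hzp).symm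
    (ne_of_mem_of_not_mem hxp hwp).symm (ne_of_mem_of_not_mem hyp hwp).symm
  obtain ⟨t, htc, htp⟩ := h.exists_mem_of_cross hG hc hzq hwr
  obtain ⟨htn, htx, hty⟩ := hcn t htc
  exact ((hn t htn htp).elim htx hty).elim

theorem IsTheta.exists_isTheta (hG : IsLCycleGraph {2 * k} G) {p q r s : G.Walk u v}
    (h : IsTheta p q r) (hs : s.IsPath) : ∃ q' r' : G.Walk u v, IsTheta s q' r' := by
  by_cases hps : p = s
  · exact ⟨q, r, hps ▸ h⟩
  by_cases hqs : q = s
  · exact ⟨r, p, hqs ▸ h.rotate⟩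
  refine ⟨p, q, ⟨hs, h.bigon₁₂.isPath_left, Ne.symm hps, ?_⟩,
    ⟨hs, h.bigon₁₂.isPath_right, Ne.symm hqs, ?_⟩, h.bigon₁₂⟩
  · exact (h.internallyDisjoint hG hs hps).symm
  · exact (h.rotate.internallyDisjoint hG hs hqs).symm

end Theta

section ThetaExistence

variable {V : Type*} {G : SimpleGraph V} {u v x y z : V}

theorem isCycle_append_comm {p : G.Walk x y} {q : G.Walk y x} (h : (p.append q).IsCycle) :
    (q.append p).IsCycle := by
  have hnodup := h.support_nodup
  rw [tail_support_append] at hnodup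
  have htrail := h.isTrail
  rw [isTrail_def, edges_append] at htrail
  refine (isCycle_def _).2 ⟨?_, fun hnil => h.ne_nil ?_, ?_⟩
  · rwa [isTrail_def, edges_append, List.nodup_append_comm]
  · have := congrArg Walk.length hnil
    rw [length_append, length_nil, Nat.add_comm, ← length_append] at this
    exact (length_eq_zero_iff.1 this).eq_nil
  · rwa [tail_support_append, List.nodup_append_comm]

/-- Going round the cycle formed by a `u`-`v` path and the edge `vu`, from one vertex of the path
to another. -/
theorem isBigon_of_isPath_append_append (h : G.Adj v u) {a : G.Walk u x} {m : G.Walk x y}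
    {b : G.Walk y v} (hp : (a.append (m.append b)).IsPath) (hxy : x ≠ y)
    (he : s(v, u) ∉ (a.append (m.append b)).edges) :
    IsBigon m (b.append (cons h a)).reverse := by
  have hcycle : ((cons h a).append (m.append b)).IsCycle := (cons_isCycle_iff _ h).2 ⟨hp, he⟩
  refine isBigon_of_isCycle_append ?_ hxy
  simpa only [append_assoc] using isCycle_append_comm hcycle

/-- An ear of `p` cut out by `q` and the segment of `p` that it bypasses; the third path goes
through the edge `vu`. -/
theorem exists_isTheta_of_adj (h : G.Adj v u) {p q : G.Walk u v} (hp : p.IsPath) (hq : q.IsPath)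
    (hpq : p ≠ q) (hpe : s(v, u) ∉ p.edges) (hqe : s(v, u) ∉ q.edges) :
    ∃ (x y : V) (p' q' r' : G.Walk x y), IsTheta p' q' r' := by
  obtain ⟨x, y, a, m, n, b, b', rfl, rfl, hmn, hn⟩ := exists_ear hp hq hpq
  have hpath := isPath_append_append_of_forall hp hmn.isPath_right hn
  refine ⟨x, y, m, n, _, hmn, isBigon_of_isPath_append_append h hp hmn.ends_ne hpe,
    isBigon_of_isPath_append_append h hpath hmn.ends_ne ?_⟩
  simp only [edges_append, List.mem_append, not_or] at hpe hqe ⊢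
  exact ⟨hpe.1, hqe.2.1, hpe.2.2⟩

theorem exists_forall_isPath_or_exists_isTheta {c : G.Walk z z} (hc : c.IsCycle) :
    (∃ (u v : V) (p q : G.Walk u v), IsBigon p q ∧ q.length + 1 = c.length ∧
      ∀ s : G.Walk u v, s.IsPath → s = p ∨ s = q) ∨
    ∃ (x y : V) (p q r : G.Walk x y), IsTheta p q r := by
  cases c with
  | nil => exact absurd hc not_isCycle_nil
  | @cons _ v _ h q =>
    obtain ⟨hq, hqe⟩ := (cons_isCycle_iff q h).1 hc
    by_cases hall : ∀ s : G.Walk v z, s.IsPath → s(z, v) ∉ s.edges → s = q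
    · left
      refine ⟨v, z, h.symm.toWalk, q, ⟨by simp [h.ne'], hq, ?_, ?_⟩, by simp, fun s hs => ?_⟩
      · rintro rfl
        exact hqe (by simp)
      · intro w hw _
        simpa using hw
      · refine or_iff_not_imp_right.2 fun hsq => hs.eq_adj_toWalk_of_mem_edges ?_
        rw [Sym2.eq_swap]
        by_contra hse
        exact hsq (hall s hs hse)
    · right
      push Not at hall
      obtain ⟨s, hs, hse, hsq⟩ := hall
      exact exists_isTheta_of_adj h hs hq hsq hse hqe

end ThetaExistence

section Deletion

variable {V : Type*} {G : SimpleGraph V} {u v w x y z : V} {L : Set ℕ} {k : ℕ}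

theorem isLCycleGraph_of_le {G' : SimpleGraph V} (hG : IsLCycleGraph L G) (h : G' ≤ G) :
    IsLCycleGraph L G' := fun v p hp => by
  simpa only [Walk.mapLe, length_map] using hG v (p.mapLe h) (hp.mapLe h)

theorem card_connectedComponent_add_ncard_le [Finite V] {G' : SimpleGraph V} (h : G' ≤ G)
    {S : Set V} {c : G.ConnectedComponent} (hc : ∀ x ∈ S, G.connectedComponentMk x = c)
    (hS : Set.InjOn G'.connectedComponentMk S) :
    Nat.card G.ConnectedComponent + S.ncard ≤ Nat.card G'.ConnectedComponent + 1 := by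
  let φ : G'.ConnectedComponent → G.ConnectedComponent := ConnectedComponent.map (Hom.ofLE h)
  let T : Set G'.ConnectedComponent := G'.connectedComponentMk '' S
  have hT : T.ncard = S.ncard := hS.ncard_image
  have hcompl : ({c}ᶜ : Set G.ConnectedComponent) ⊆ φ '' Tᶜ := by
    intro d hd
    induction d using ConnectedComponent.ind with | _ x
    refine ⟨G'.connectedComponentMk x, ?_, rfl⟩
    rintro ⟨s, hs, hsx⟩
    exact hd ((congrArg φ hsx).symm.trans (hc s hs))
  have hle := (Set.ncard_le_ncard hcompl).trans (Set.ncard_image_le (Set.toFinite Tᶜ))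
  have hcardT := Set.ncard_add_ncard_compl T
  have hcard := Set.ncard_add_ncard_compl {c}
  rw [Set.ncard_singleton] at hcard
  lia

/-- The edges of the paths from `u` to `v`. -/
def pathEdges (G : SimpleGraph V) (u v : V) : Set (Sym2 V) :=
  {e | ∃ p : G.Walk u v, p.IsPath ∧ e ∈ p.edges}

/-- The vertices of the paths from `u` to `v`. -/
def pathVerts (G : SimpleGraph V) (u v : V) : Set V :=
  {w | ∃ p : G.Walk u v, p.IsPath ∧ w ∈ p.support}

theorem exists_walk_of_mem_pathVerts (hw : w ∈ pathVerts G u v) :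
    ∃ q : G.Walk u w, ∀ e ∈ q.edges, e ∈ pathEdges G u v := by
  obtain ⟨p, hp, hw⟩ := hw
  obtain ⟨q, r, rfl⟩ := Walk.mem_support_iff_exists_append.1 hw
  exact ⟨q, fun e he => ⟨_, hp, by simp [he]⟩⟩

theorem exists_mem_edges (p : G.Walk x y) (hxy : x ≠ y) : ∃ e, e ∈ p.edges := by
  cases p with
  | nil => exact absurd rfl hxy
  | cons h p => exact ⟨_, List.mem_cons_self⟩

theorem exists_isCycle_mem_edges {E : Set (Sym2 V)} {p q : G.Walk x y} (hp : p.IsPath)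
    (hq : q.IsPath) (hxy : x ≠ y) (hpE : ∀ e ∈ p.edges, e ∈ E) (hqE : ∀ e ∈ q.edges, e ∉ E) :
    ∃ (z : V) (c : G.Walk z z), c.IsCycle ∧ (∃ e ∈ c.edges, e ∈ E) ∧ ∃ e ∈ c.edges, e ∉ E := by
  have hpq : p ≠ q := by
    rintro rfl
    obtain ⟨e, he⟩ := exists_mem_edges p hxy
    exact hqE e he (hpE e he)
  obtain ⟨x', y', a, m, n, b, b', rfl, rfl, hmn, -⟩ := exists_ear hp hq hpq
  obtain ⟨e, he⟩ := exists_mem_edges m hmn.ends_ne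
  obtain ⟨f, hf⟩ := exists_mem_edges n hmn.ends_ne
  exact ⟨x', _, hmn.isCycle, ⟨e, by simp [he], hpE e (by simp [he])⟩,
    ⟨f, by simp [hf], hqE f (by simp [hf])⟩⟩

theorem PathsDisjoint.mem_pathEdges_of_isCycle (h : PathsDisjoint G u v) {c : G.Walk z z}
    (hc : c.IsCycle) {e f : Sym2 V} (hec : e ∈ c.edges) (he : e ∈ pathEdges G u v)
    (hfc : f ∈ c.edges) : f ∈ pathEdges G u v := by
  obtain ⟨p, hp, hep⟩ := he
  obtain ⟨q, r, hqr, hsub⟩ := h.exists_isBigon_toSubgraph_eq hc hp hep hec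
  rw [← Walk.mem_edges_toSubgraph, hsub, Subgraph.edgeSet_sup] at hfc
  exact hfc.elim (fun hf => ⟨q, hqr.isPath_left, q.mem_edges_toSubgraph.1 hf⟩)
    fun hf => ⟨r, hqr.isPath_right, r.mem_edges_toSubgraph.1 hf⟩

theorem PathsDisjoint.injOn_connectedComponentMk (h : PathsDisjoint G u v) :
    Set.InjOn (G.deleteEdges (pathEdges G u v)).connectedComponentMk (pathVerts G u v) := by
  classical
  intro x hx y hy hxy
  by_contra hne
  obtain ⟨q, hq⟩ := (ConnectedComponent.exact hxy).exists_isPath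
  obtain ⟨a, ha⟩ := exists_walk_of_mem_pathVerts hx
  obtain ⟨b, hb⟩ := exists_walk_of_mem_pathVerts hy
  have hqE : ∀ e ∈ (q.mapLe (deleteEdges_le _)).edges, e ∉ pathEdges G u v := by
    intro e he
    have he' := q.edges_subset_edgeSet (by simpa using he)
    rw [edgeSet_deleteEdges] at he'
    exact he'.2
  have hpE : ∀ e ∈ (a.reverse.append b).bypass.edges, e ∈ pathEdges G u v := by
    intro e he
    have he' := edges_bypass_subset_edges _ he
    simp only [edges_append, edges_reverse, List.mem_append, List.mem_reverse] at he'
    exact he'.elim (ha e) (hb e)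
  obtain ⟨z, c, hc, ⟨e, hec, he⟩, f, hfc, hf⟩ :=
    exists_isCycle_mem_edges (bypass_isPath _) (hq.mapLe _) hne hpE hqE
  exact hf (h.mem_pathEdges_of_isCycle hc hec he hfc)

theorem PathsDisjoint.card_connectedComponent_add_le [Finite V] (h : PathsDisjoint G u v) :
    Nat.card G.ConnectedComponent + (pathVerts G u v).ncard ≤
      Nat.card (G.deleteEdges (pathEdges G u v)).ConnectedComponent + 1 := by
  refine card_connectedComponent_add_ncard_le (c := G.connectedComponentMk u) (deleteEdges_le _)
    (fun x hx => ?_) h.injOn_connectedComponentMk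
  obtain ⟨q, -⟩ := exists_walk_of_mem_pathVerts hx
  exact ConnectedComponent.sound q.reverse.reachable

theorem toSubgraph_mem_image_cyclesOf {E : Set (Sym2 V)} {c : G.Walk z z} (hc : c.IsCycle)
    (h : ∀ e ∈ c.edges, e ∉ E) :
    c.toSubgraph ∈ Subgraph.map (Hom.ofLE (deleteEdges_le E)) '' cyclesOf (G.deleteEdges E) := by
  refine ⟨_, ⟨z, c.toDeleteEdges E h, IsCycle.toDeleteEdges _ E hc h, rfl⟩, ?_⟩
  rw [← toSubgraph_map, map_toDeleteEdges_eq]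

theorem PathsDisjoint.cyclesOf_subset (h : PathsDisjoint G u v) :
    cyclesOf G ⊆ Subgraph.map (Hom.ofLE (deleteEdges_le (pathEdges G u v))) ''
        cyclesOf (G.deleteEdges (pathEdges G u v)) ∪
      (fun s : Finset (G.Path u v) => s.sup fun p => p.1.toSubgraph) '' Set.powersetCard _ 2 := by
  classical
  rintro _ ⟨z, c, hc, rfl⟩
  by_cases hce : ∀ e ∈ c.edges, e ∉ pathEdges G u v
  · exact Or.inl (toSubgraph_mem_image_cyclesOf hc hce)
  · push Not at hce
    obtain ⟨e, hec, p, hp, hep⟩ := hce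
    obtain ⟨q, r, hqr, hsub⟩ := h.exists_isBigon_toSubgraph_eq hc hp hep hec
    refine Or.inr ⟨{⟨q, hqr.isPath_left⟩, ⟨r, hqr.isPath_right⟩},
      Finset.card_pair fun heq => hqr.ne (congrArg Subtype.val heq), ?_⟩
    simp only [hsub, Finset.sup_insert, Finset.sup_singleton]

theorem PathsDisjoint.numCycles_le [Finite V] (h : PathsDisjoint G u v) :
    numCycles G ≤ numCycles (G.deleteEdges (pathEdges G u v)) +
      (Nat.card (G.Path u v)).choose 2 := by
  classical
  have := Fintype.ofFinite V
  calc numCycles G ≤ _ := Set.ncard_le_ncard h.cyclesOf_subset (Set.toFinite _)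
    _ ≤ _ := Set.ncard_union_le _ _
    _ ≤ _ := Nat.add_le_add (Set.ncard_image_le (Set.toFinite _))
      ((Set.ncard_image_le (Set.toFinite _)).trans (Set.powersetCard.card _ _).le)

theorem PathsDisjoint.two_add_card_mul_le_ncard_pathVerts [Finite V] (h : PathsDisjoint G u v)
    (huv : u ≠ v) (hG : G.Reachable u v) (hk : ∀ p : G.Walk u v, p.IsPath → p.length = k) :
    2 + Nat.card (G.Path u v) * (k - 1) ≤ (pathVerts G u v).ncard := by
  classical
  have := Fintype.ofFinite V
  let I : G.Path u v → Finset V := fun p => p.1.support.toFinset \ {u, v}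
  have hI : ∀ p, (I p).card = k - 1 := by
    intro p
    rw [Finset.card_sdiff_of_subset (by simp [Finset.insert_subset_iff]), Finset.card_pair huv,
      List.toFinset_card_of_nodup p.2.support_nodup, length_support, hk _ p.2]
    lia
  have hdisj : Set.PairwiseDisjoint (Finset.univ : Finset (G.Path u v)) I := by
    intro p _ q _ hpq
    refine Finset.disjoint_left.2 fun w hwp hwq => ?_
    have := h p.1 q.1 p.2 q.2 (fun heq => hpq (Subtype.ext heq)) w
    simp only [I, Finset.mem_sdiff, List.mem_toFinset, Finset.mem_insert,
      Finset.mem_singleton] at hwp hwq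
    exact hwp.2 (this hwp.1 hwq.1)
  have hends : Disjoint {u, v} (Finset.univ.biUnion I) := by
    simp only [I, Finset.disjoint_biUnion_right, Finset.disjoint_sdiff, implies_true]
  have hsubset : (({u, v} ∪ Finset.univ.biUnion I : Finset V) : Set V) ⊆ pathVerts G u v := by
    obtain ⟨p, hp⟩ := hG.exists_isPath
    intro w hw
    simp only [Finset.coe_union, Set.mem_union, Finset.mem_coe, Finset.mem_insert,
      Finset.mem_singleton, Finset.mem_biUnion, Finset.mem_univ, true_and] at hw
    rcases hw with (rfl | rfl) | ⟨q, hq⟩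
    · exact ⟨p, hp, p.start_mem_support⟩
    · exact ⟨p, hp, p.end_mem_support⟩
    · exact ⟨q.1, q.2, List.mem_toFinset.1 (Finset.mem_sdiff.1 hq).1⟩
  calc 2 + Nat.card (G.Path u v) * (k - 1)
      = ({u, v} ∪ Finset.univ.biUnion I : Finset V).card := by
        rw [Finset.card_union_of_disjoint hends, Finset.card_pair huv, Finset.card_biUnion hdisj]
        simp only [hI, Finset.sum_const, Finset.card_univ, smul_eq_mul, Nat.card_eq_fintype_card]
    _ ≤ (pathVerts G u v).ncard := by
        rw [← Set.ncard_coe_finset]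
        exact Set.ncard_le_ncard hsubset

theorem deleteEdges_pathEdges_lt (huv : u ≠ v) (h : G.Reachable u v) :
    G.deleteEdges (pathEdges G u v) < G := by
  refine lt_of_le_of_ne (deleteEdges_le _) fun heq => ?_
  obtain ⟨p, hp⟩ := h.exists_isPath
  obtain ⟨e, he⟩ := exists_mem_edges p huv
  rw [deleteEdges_eq_self, Set.disjoint_left] at heq
  exact heq (p.edges_subset_edgeSet he) ⟨p, hp, he⟩

end Deletion

section UpperBounds

variable {V : Type*} {G : SimpleGraph V} {u v z : V} {L : Set ℕ} {k : ℕ}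

theorem IsTheta.pathsDisjoint (hG : IsLCycleGraph {2 * k} G) {p q r : G.Walk u v}
    (h : IsTheta p q r) : PathsDisjoint G u v := by
  intro s t hs ht hst
  obtain ⟨q', r', h'⟩ := h.exists_isTheta hG hs
  exact h'.internallyDisjoint hG ht hst

theorem IsTheta.exists_lt [Finite V] (hG : IsLCycleGraph {2 * k} G) {p q r : G.Walk u v}
    (h : IsTheta p q r) :
    ∃ G' < G, ∃ m : ℕ, numCycles G ≤ numCycles G' + m.choose 2 ∧
      Nat.card G.ConnectedComponent + (2 + m * (k - 1)) ≤ Nat.card G'.ConnectedComponent + 1 := by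
  have huv := h.bigon₁₂.ends_ne
  have hdisj := h.pathsDisjoint hG
  have hlen : ∀ s : G.Walk u v, s.IsPath → s.length = k := by
    intro s hs
    obtain ⟨q', r', h'⟩ := h.exists_isTheta hG hs
    exact h'.length_eq hG
  refine ⟨_, deleteEdges_pathEdges_lt huv ⟨p⟩, _, hdisj.numCycles_le, ?_⟩
  have hverts := hdisj.two_add_card_mul_le_ncard_pathVerts huv ⟨p⟩ hlen
  have hcomp := hdisj.card_connectedComponent_add_le
  lia

theorem IsBigon.exists_lt [Finite V] {p q : G.Walk u v} (h : IsBigon p q)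
    (hall : ∀ s : G.Walk u v, s.IsPath → s = p ∨ s = q) :
    ∃ G' < G, numCycles G ≤ numCycles G' + 1 ∧
      Nat.card G.ConnectedComponent + (q.length + 1) ≤ Nat.card G'.ConnectedComponent + 1 := by
  classical
  have hdisj : PathsDisjoint G u v := by
    intro s t hs ht hst
    rcases hall s hs with rfl | rfl <;> rcases hall t ht with rfl | rfl
    · exact absurd rfl hst
    · exact h.internallyDisjoint
    · exact h.internallyDisjoint.symm
    · exact absurd rfl hst
  have hcard : Nat.card (G.Path u v) ≤ 2 := by
    have huniv : (Set.univ : Set (G.Path u v)) ⊆ {⟨p, h.isPath_left⟩, ⟨q, h.isPath_right⟩} :=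
      fun s _ => (hall s.1 s.2).imp Subtype.ext Subtype.ext
    rw [← Set.ncard_univ]
    exact (Set.ncard_le_ncard huniv).trans
      ((Set.ncard_insert_le _ _).trans (by rw [Set.ncard_singleton]))
  have hverts : q.length + 1 ≤ (pathVerts G u v).ncard := by
    rw [← length_support, ← List.toFinset_card_of_nodup h.isPath_right.support_nodup,
      ← Set.ncard_coe_finset]
    exact Set.ncard_le_ncard fun w hw => ⟨q, h.isPath_right, by simpa using hw⟩
  refine ⟨_, deleteEdges_pathEdges_lt h.ends_ne ⟨p⟩, hdisj.numCycles_le.trans ?_, ?_⟩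
  · exact Nat.add_le_add_left (Nat.choose_le_choose 2 hcard) _
  · exact (Nat.add_le_add_left hverts _).trans hdisj.card_connectedComponent_add_le

theorem card_connectedComponent_le [Finite V] (G : SimpleGraph V) :
    Nat.card G.ConnectedComponent ≤ Nat.card V :=
  Nat.card_le_card_of_surjective G.connectedComponentMk Quot.mk_surjective

theorem numCycles_eq_zero (h : G.IsAcyclic) : numCycles G = 0 := by
  have hempty : cyclesOf G = ∅ := by
    rw [Set.eq_empty_iff_forall_notMem]
    rintro _ ⟨z, c, hc, -⟩
    exact h c hc
  rw [numCycles, hempty, Set.ncard_empty]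

theorem numCycles_mul_add_card_le [Finite V] (hL : ∀ m ∈ L, Odd m) (hk : ∀ m ∈ L, 2 * k + 1 ≤ m)
    (hG : IsLCycleGraph L G) :
    numCycles G * (2 * k) + Nat.card G.ConnectedComponent ≤ Nat.card V := by
  induction G using WellFoundedLT.induction with | _ G ih
  by_cases hacyc : G.IsAcyclic
  · rw [numCycles_eq_zero hacyc, zero_mul, zero_add]
    exact card_connectedComponent_le G
  · simp only [IsAcyclic, not_forall, not_not] at hacyc
    obtain ⟨z, c, hc⟩ := hacyc
    rcases exists_forall_isPath_or_exists_isTheta hc with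
      ⟨u, v, p, q, hpq, hqc, hall⟩ | ⟨x, y, p, q, r, h⟩
    · obtain ⟨G', hlt, hcyc, hcomp⟩ := hpq.exists_lt hall
      have hG' := ih G' hlt (isLCycleGraph_of_le hG hlt.le)
      have hlen := hk _ (hG z c hc)
      have hmul := Nat.mul_le_mul_right (2 * k) hcyc
      rw [add_mul, one_mul] at hmul
      lia
    · exact (not_isTheta_of_forall_odd hL hG p q r h).elim

theorem choose_two_add_choose_two_le (m n : ℕ) : m.choose 2 + n.choose 2 ≤ (m + n).choose 2 := by
  rw [Nat.add_choose_eq, Finset.Nat.sum_antidiagonal_eq_sum_range_succ_mk]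
  simp only [Finset.sum_range_succ, Finset.sum_range_zero, Nat.choose_zero_right, tsub_zero,
    one_mul, zero_add, Nat.choose_one_right, Nat.add_one_sub_one, tsub_self, mul_one]
  lia

theorem numCycles_le_choose_two [Finite V] (hk : 2 ≤ k) (hG : IsLCycleGraph {2 * k} G) :
    numCycles G ≤ ((Nat.card V - Nat.card G.ConnectedComponent - 1) / (k - 1)).choose 2 := by
  induction G using WellFoundedLT.induction with | _ G ih
  by_cases hacyc : G.IsAcyclic
  · rw [numCycles_eq_zero hacyc]
    exact Nat.zero_le _
  · simp only [IsAcyclic, not_forall, not_not] at hacyc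
    obtain ⟨z, c, hc⟩ := hacyc
    have hshrink : ∃ G' < G, ∃ m : ℕ, numCycles G ≤ numCycles G' + m.choose 2 ∧
        Nat.card G.ConnectedComponent + (2 + m * (k - 1)) ≤
          Nat.card G'.ConnectedComponent + 1 := by
      rcases exists_forall_isPath_or_exists_isTheta hc with
        ⟨u, v, p, q, hpq, hqc, hall⟩ | ⟨x, y, p, q, r, h⟩
      · obtain ⟨G', hlt, hcyc, hcomp⟩ := hpq.exists_lt hall
        have hlen : c.length = 2 * k := hG z c hc
        exact ⟨G', hlt, 2, by simpa using hcyc, by lia⟩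
      · exact h.exists_lt hG
    obtain ⟨G', hlt, m, hcyc, hcomp⟩ := hshrink
    refine (hcyc.trans (Nat.add_le_add_right (ih G' hlt (isLCycleGraph_of_le hG hlt.le)) _)).trans
      ((choose_two_add_choose_two_le _ _).trans (Nat.choose_le_choose 2 ?_))
    rw [Nat.le_div_iff_mul_le (by lia), add_mul]
    have hdiv := Nat.div_mul_le_self (Nat.card V - Nat.card G'.ConnectedComponent - 1) (k - 1)
    have hV := card_connectedComponent_le G'
    lia

theorem maxCycles_le_of_forall_odd (hk : 1 ≤ k) (hL : ∀ m ∈ L, Odd m)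
    (hmin : ∀ m ∈ L, 2 * k + 1 ≤ m) (n : ℕ) : maxCycles L n ≤ (n - 1) / (2 * k) := by
  obtain ⟨G, hG, hmax⟩ := (isGreatest_maxCycles L n).1
  have hle := numCycles_mul_add_card_le hL hmin hG
  rw [hmax, Nat.card_fin] at hle
  rw [Nat.le_div_iff_mul_le (by lia)]
  rcases n.eq_zero_or_pos with rfl | hn
  · lia
  · have : Nonempty (Fin n) := ⟨⟨0, hn⟩⟩
    have : 0 < Nat.card G.ConnectedComponent := Nat.card_pos
    lia

theorem maxCycles_le_choose_two (hk : 2 ≤ k) (n : ℕ) :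
    maxCycles {2 * k} n ≤ ((n - 2) / (k - 1)).choose 2 := by
  obtain ⟨G, hG, hmax⟩ := (isGreatest_maxCycles {2 * k} n).1
  have hle := numCycles_le_choose_two hk hG
  rw [hmax, Nat.card_fin] at hle
  refine hle.trans (Nat.choose_le_choose 2 (Nat.div_le_div_right ?_))
  rcases n.eq_zero_or_pos with rfl | hn
  · lia
  · have : Nonempty (Fin n) := ⟨⟨0, hn⟩⟩
    have : 0 < Nat.card G.ConnectedComponent := Nat.card_pos
    lia

end UpperBounds

section Transfer

variable {V W : Type*} {G : SimpleGraph V} {G' : SimpleGraph W} {L : Set ℕ}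

theorem isLCycleGraph_of_iso (f : G ≃g G') (hG : IsLCycleGraph L G) : IsLCycleGraph L G' := by
  intro v p hp
  simpa only [length_map] using hG _ (p.map f.symm.toHom) (hp.map f.symm.injective)

theorem numCycles_le_of_iso [Finite W] (f : G ≃g G') : numCycles G ≤ numCycles G' := by
  have hinj : Function.Injective (Subgraph.map f.toHom) := by
    refine Function.LeftInverse.injective (g := Subgraph.map f.symm.toHom) fun H => ?_
    have hid : f.symm.toHom.comp f.toHom = Hom.id := RelHom.ext f.symm_apply_apply
    rw [← Subgraph.map_comp, hid, Subgraph.map_id]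
  rw [numCycles, ← Set.ncard_image_of_injective _ hinj]
  refine Set.ncard_le_ncard ?_
  rintro _ ⟨_, ⟨v, p, hp, rfl⟩, rfl⟩
  exact ⟨_, p.map f.toHom, hp.map f.injective, toSubgraph_map _ _⟩

theorem numCycles_le_maxCycles [Finite V] {n : ℕ} (hn : Nat.card V = n)
    (hG : IsLCycleGraph L G) : numCycles G ≤ maxCycles L n := by
  have := Fintype.ofFinite V
  let f := G.overFinIso (Nat.card_eq_fintype_card.symm.trans hn)
  exact (numCycles_le_of_iso f).trans
    ((isGreatest_maxCycles L n).2 ⟨_, isLCycleGraph_of_iso f hG, rfl⟩)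

end Transfer

section CycleNeighbors

variable {V : Type*} {G : SimpleGraph V} {w x a b z : V}

theorem ncard_verts_toSubgraph_of_isCycle {p : G.Walk z z} (hp : p.IsCycle) :
    p.toSubgraph.verts.ncard = p.length := by
  classical
  have hverts : p.toSubgraph.verts = p.support.tail.toFinset := by
    ext w
    rw [mem_verts_toSubgraph, Finset.mem_coe, List.mem_toFinset, mem_support_iff,
      or_iff_right_iff_imp]
    rintro rfl
    exact end_mem_tail_support hp.not_nil
  rw [hverts, Set.ncard_coe_finset, List.toFinset_card_of_nodup hp.support_nodup,
    List.length_tail, length_support, Nat.add_sub_cancel]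

theorem toSubgraph_adj_of_neighborSet_subset {p : G.Walk z z} (hp : p.IsCycle)
    (hw : w ∈ p.support) (h : G.neighborSet w ⊆ {a, b}) (hx : G.Adj w x) :
    p.toSubgraph.Adj w x := by
  have hle : (G.neighborSet w).ncard ≤ (p.toSubgraph.neighborSet w).ncard := by
    rw [hp.ncard_neighborSet_toSubgraph_eq_two hw]
    refine (Set.ncard_le_ncard h).trans ((Set.ncard_insert_le _ _).trans ?_)
    rw [Set.ncard_singleton]
  have heq := Set.eq_of_subset_of_ncard_le (p.toSubgraph.neighborSet_subset w) hle
    ((Set.toFinite _).subset h)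
  exact heq.ge hx

end CycleNeighbors

section ThreadGraph

variable {ι X : Type*} {c : ℕ} {s e : X} {i : ι} {j : Fin (c + 1)}

/-- The graph formed by a family of paths, called threads, from `s` to `e`, indexed by `ι`, each
with the `c + 1` inner vertices `inr (i, j)`. It is extremal: for `s = e` it is a family of cycles
through one vertex, for `s ≠ e` a generalized theta graph. The other elements of `X` are isolated
vertices. -/
def threadGraph (ι : Type*) {X : Type*} (c : ℕ) (s e : X) : SimpleGraph (X ⊕ ι × Fin (c + 1)) where
  Adj
    | .inl _, .inl _ => False
    | .inl x, .inr (_, j) => x = s ∧ j = 0 ∨ x = e ∧ j = Fin.last c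
    | .inr (_, j), .inl x => x = s ∧ j = 0 ∨ x = e ∧ j = Fin.last c
    | .inr (i, j), .inr (i', j') => i = i' ∧ (pathGraph (c + 1)).Adj j j'
  symm := ⟨by
    rintro (x | ⟨i, j⟩) (y | ⟨i', j'⟩) h
    exacts [h, h, h, ⟨h.1.symm, h.2.symm⟩]⟩
  loopless := ⟨by
    rintro (x | ⟨i, j⟩) h
    exacts [h, h.2.ne rfl]⟩

theorem neighborSet_threadGraph_inr_subset (i : ι) (j : Fin (c + 1)) :
    ∃ a b, (threadGraph ι c s e).neighborSet (.inr (i, j)) ⊆ {a, b} := by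
  refine ⟨if j = 0 then .inl s else .inr (i, ⟨j - 1, by lia⟩),
    if h : j = Fin.last c then .inl e else .inr (i, ⟨j + 1, by grind⟩), ?_⟩
  rintro (x | ⟨i', j'⟩) h
  · rcases h with ⟨rfl, rfl⟩ | ⟨rfl, rfl⟩ <;> simp
  · obtain ⟨rfl, h⟩ := h
    rw [pathGraph_adj] at h
    grind

variable {z : X ⊕ ι × Fin (c + 1)} {p : (threadGraph ι c s e).Walk z z}

theorem toSubgraph_adj_of_inr_mem_support (hp : p.IsCycle) (h : .inr (i, j) ∈ p.support)
    {w : X ⊕ ι × Fin (c + 1)} (hw : (threadGraph ι c s e).Adj (.inr (i, j)) w) :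
    p.toSubgraph.Adj (.inr (i, j)) w := by
  obtain ⟨a, b, hab⟩ := neighborSet_threadGraph_inr_subset (s := s) (e := e) i j
  exact toSubgraph_adj_of_neighborSet_subset hp h hab hw

theorem mem_support_of_adj_inr (hp : p.IsCycle) (h : .inr (i, j) ∈ p.support)
    {w : X ⊕ ι × Fin (c + 1)} (hw : (threadGraph ι c s e).Adj (.inr (i, j)) w) :
    w ∈ p.support := by
  rw [← mem_verts_toSubgraph]
  exact (toSubgraph_adj_of_inr_mem_support hp h hw).snd_mem

theorem inr_mem_support (hp : p.IsCycle) (h : .inr (i, j) ∈ p.support) (j' : Fin (c + 1)) :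
    .inr (i, j') ∈ p.support := by
  obtain ⟨q⟩ := pathGraph_preconnected (c + 1) j j'
  induction q with
  | nil => exact h
  | cons hadj _ ih => exact ih (mem_support_of_adj_inr hp h ⟨rfl, hadj⟩)

/-- The threads traversed by a walk. A cycle that visits one inner vertex of a thread traverses the
thread entirely, so it suffices to look at the first one. -/
def threads (p : (threadGraph ι c s e).Walk z z) : Set ι := {i | .inr (i, 0) ∈ p.support}

theorem inr_mem_support_iff (hp : p.IsCycle) : .inr (i, j) ∈ p.support ↔ i ∈ threads p :=
  ⟨fun h => inr_mem_support hp h 0, fun h => inr_mem_support hp h j⟩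

theorem threads_nonempty (hp : p.IsCycle) : (threads p).Nonempty := by
  have hstart := p.start_mem_support
  have hsnd : p.snd ∈ p.support := p.getVert_mem_support 1
  have hadj := p.adj_snd hp.not_nil
  rcases z with x | ⟨i, j⟩
  · generalize hw : p.snd = w at hadj
    rcases w with y | ⟨i, j⟩
    · exact hadj.elim
    · exact ⟨i, (inr_mem_support_iff hp).1 (hw ▸ hsnd)⟩
  · exact ⟨i, (inr_mem_support_iff hp).1 hstart⟩

theorem inl_mem_support_iff (hp : p.IsCycle) {x : X} : .inl x ∈ p.support ↔ x = s ∨ x = e := by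
  constructor
  · intro h
    have hpos : (p.toSubgraph.neighborSet (.inl x)).Nonempty := by
      refine Set.nonempty_of_ncard_ne_zero ?_
      rw [hp.ncard_neighborSet_toSubgraph_eq_two h]
      exact two_ne_zero
    obtain ⟨y | ⟨i, j⟩, hy⟩ := hpos
    · exact (p.toSubgraph.adj_sub hy).elim
    · exact (p.toSubgraph.adj_sub hy).imp And.left And.left
  · obtain ⟨i, hi⟩ := threads_nonempty hp
    have hmem : ∀ j, .inr (i, j) ∈ p.support := fun j => (inr_mem_support_iff hp).2 hi
    rintro (rfl | rfl)
    · exact mem_support_of_adj_inr hp (hmem 0) (Or.inl ⟨rfl, rfl⟩)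
    · exact mem_support_of_adj_inr hp (hmem (Fin.last c)) (Or.inr ⟨rfl, rfl⟩)

theorem length_eq_of_isCycle [Finite ι] (hp : p.IsCycle) :
    p.length = ({s, e} : Set X).ncard + (threads p).ncard * (c + 1) := by
  have hverts : p.toSubgraph.verts = Sum.inl '' {s, e} ∪ Sum.inr '' (threads p ×ˢ Set.univ) := by
    ext (x | ⟨i, j⟩)
    · simp [inl_mem_support_iff hp]
    · simp [inr_mem_support_iff hp]
  rw [← ncard_verts_toSubgraph_of_isCycle hp, hverts,
    Set.ncard_union_eq Set.disjoint_image_inl_image_inr,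
    Set.ncard_image_of_injective _ Sum.inl_injective,
    Set.ncard_image_of_injective _ Sum.inr_injective, Set.ncard_prod, Set.ncard_univ, Nat.card_fin]

/-- A cycle has two edges at `s`, each of which is the first or, if `s = e`, the last edge of a
thread. -/
theorem ncard_threads_mul_ncard (hp : p.IsCycle) :
    (threads p).ncard * {j : Fin (c + 1) | j = 0 ∨ s = e ∧ j = Fin.last c}.ncard = 2 := by
  have hnbr : p.toSubgraph.neighborSet (.inl s) =
      Sum.inr '' (threads p ×ˢ {j | j = 0 ∨ s = e ∧ j = Fin.last c}) := by
    ext (x | ⟨i, j⟩)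
    · refine iff_of_false (fun h => ?_) (by simp)
      exact p.toSubgraph.adj_sub h
    · simp only [Subgraph.mem_neighborSet, Set.mem_image, Set.mem_prod, Set.mem_ofPred_eq,
        Sum.inr.injEq, exists_eq_right]
      constructor
      · intro h
        refine ⟨(inr_mem_support_iff (j := j) hp).1 ?_, ?_⟩
        · simpa using h.snd_mem
        · simpa [threadGraph] using p.toSubgraph.adj_sub h
      · rintro ⟨hi, hj⟩
        refine (toSubgraph_adj_of_inr_mem_support hp ((inr_mem_support_iff hp).2 hi) ?_).symm
        simpa [threadGraph] using hj
  rw [← Set.ncard_prod, ← Set.ncard_image_of_injective _ Sum.inr_injective, ← hnbr]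
  exact hp.ncard_neighborSet_toSubgraph_eq_two ((inl_mem_support_iff hp).2 (Or.inl rfl))

theorem ncard_threads_of_ne (hp : p.IsCycle) (hse : s ≠ e) : (threads p).ncard = 2 := by
  simpa [hse] using ncard_threads_mul_ncard hp

theorem ncard_threads_of_eq (hc : c ≠ 0) {p : (threadGraph ι c s s).Walk z z} (hp : p.IsCycle) :
    (threads p).ncard = 1 := by
  have h := ncard_threads_mul_ncard hp
  have hends : {j : Fin (c + 1) | j = 0 ∨ s = s ∧ j = Fin.last c} = {0, Fin.last c} := by
    ext; simp
  rw [hends, Set.ncard_pair (by simp [hc, Fin.ext_iff, eq_comm])] at h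
  lia

theorem exists_isPath_thread (i : ι) :
    ∃ q : (threadGraph ι c s e).Walk (.inr (i, 0)) (.inr (i, Fin.last c)), q.IsPath ∧
      ∀ w ∈ q.support, ∃ j, w = .inr (i, j) := by
  obtain ⟨q, hq⟩ := (pathGraph_connected c).exists_isPath 0 (Fin.last c)
  let f : pathGraph (c + 1) →g threadGraph ι c s e := ⟨fun j => .inr (i, j), fun h => ⟨rfl, h⟩⟩
  have hf : Function.Injective f := fun j j' h => congrArg Prod.snd (Sum.inr_injective h)
  refine ⟨q.map f, hq.map hf, fun w hw => ?_⟩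
  rw [Walk.support_map, List.mem_map] at hw
  obtain ⟨j, -, rfl⟩ := hw
  exact ⟨j, rfl⟩

theorem exists_isPath_inl_inr (i : ι) :
    ∃ q : (threadGraph ι c s e).Walk (.inl s) (.inr (i, Fin.last c)), q.IsPath ∧
      .inr (i, 0) ∈ q.support ∧ ∀ w ∈ q.support, w = .inl s ∨ ∃ j, w = .inr (i, j) := by
  obtain ⟨q, hq, hqi⟩ := exists_isPath_thread (s := s) (e := e) i
  have hadj : (threadGraph ι c s e).Adj (.inl s) (.inr (i, 0)) := Or.inl ⟨rfl, rfl⟩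
  refine ⟨cons hadj q, (cons_isPath_iff _ _).2 ⟨hq, fun h => ?_⟩, by simp, fun w hw => ?_⟩
  · obtain ⟨j, hj⟩ := hqi _ h
    cases hj
  · exact (List.mem_cons.1 hw).imp_right (hqi w)

theorem exists_isPath_inl_inl (hse : s ≠ e) (i : ι) :
    ∃ q : (threadGraph ι c s e).Walk (.inl s) (.inl e), q.IsPath ∧ .inr (i, 0) ∈ q.support ∧
      ∀ w ∈ q.support, (w = .inl s ∨ w = .inl e) ∨ ∃ j, w = .inr (i, j) := by
  obtain ⟨q, hq, hi, hqi⟩ := exists_isPath_inl_inr (s := s) (e := e) (c := c) i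
  have hadj : (threadGraph ι c s e).Adj (.inr (i, Fin.last c)) (.inl e) := Or.inr ⟨rfl, rfl⟩
  have he : .inl e ∉ q.support := fun h => by
    rcases hqi _ h with h | ⟨j, h⟩
    · exact hse (Sum.inl_injective h).symm
    · cases h
  refine ⟨q.concat hadj, hq.concat he hadj, by simp [support_concat, hi], fun w hw => ?_⟩
  rw [support_concat, List.mem_append, List.mem_singleton] at hw
  grind

/-- A cycle in the union of the threads in `F` traverses all of them by its number of threads, so
distinct `F` give distinct cycles. -/
theorem choose_le_numCycles_threadGraph [Finite X] [Finite ι] (m : ℕ)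
    (hm : ∀ z (p : (threadGraph ι c s e).Walk z z), p.IsCycle → (threads p).ncard = m)
    (h : ∀ F : Finset ι, F.card = m →
      ∃ z, ∃ p : (threadGraph ι c s e).Walk z z, p.IsCycle ∧ ↑F ⊆ threads p) :
    (Nat.card ι).choose m ≤ numCycles (threadGraph ι c s e) := by
  let g : (threadGraph ι c s e).Subgraph → Set ι := fun H => {i | .inr (i, 0) ∈ H.verts}
  have hsub : (fun F : Finset ι => (F : Set ι)) '' Set.powersetCard ι m ⊆
      g '' cyclesOf (threadGraph ι c s e) := by
    rintro _ ⟨F, hF, rfl⟩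
    obtain ⟨z, p, hp, hFp⟩ := h F hF
    have heq : (F : Set ι) = threads p :=
      Set.eq_of_subset_of_ncard_le hFp (by rw [hm z p hp, Set.ncard_coe_finset]; exact hF.ge)
    refine ⟨p.toSubgraph, ⟨z, p, hp, rfl⟩, ?_⟩
    simp only [g, heq, mem_verts_toSubgraph, threads]
  calc (Nat.card ι).choose m = _ := (Set.powersetCard.card ι m).symm
    _ = _ := (Set.ncard_image_of_injective _ Finset.coe_injective).symm
    _ ≤ _ := (Set.ncard_le_ncard hsub).trans (Set.ncard_image_le (Set.toFinite _))

theorem choose_two_le_numCycles_threadGraph [Finite X] [Finite ι] (hse : s ≠ e) :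
    (Nat.card ι).choose 2 ≤ numCycles (threadGraph ι c s e) := by
  classical
  refine choose_le_numCycles_threadGraph 2 (fun z p hp => ncard_threads_of_ne hp hse) fun F hF => ?_
  obtain ⟨a, b, hab, rfl⟩ := Finset.card_eq_two.1 hF
  obtain ⟨p, hp, hap, hps⟩ := exists_isPath_inl_inl (c := c) hse a
  obtain ⟨q, hq, hbq, hqs⟩ := exists_isPath_inl_inl (c := c) hse b
  have hbigon : IsBigon p q := by
    refine ⟨hp, hq, ?_, fun w hwp hwq => ?_⟩
    · rintro rfl
      simpa [hab] using hqs _ hap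
    · rcases hps w hwp with h | ⟨j, rfl⟩
      · exact h
      · simpa [hab] using hqs _ hwq
  refine ⟨_, _, hbigon.isCycle, ?_⟩
  rw [Finset.coe_pair, Set.insert_subset_iff, Set.singleton_subset_iff]
  simp [threads, hap, hbq]

theorem card_le_numCycles_threadGraph [Finite X] [Finite ι] (hc : c ≠ 0) :
    Nat.card ι ≤ numCycles (threadGraph ι c s s) := by
  rw [← Nat.choose_one_right (Nat.card ι)]
  refine choose_le_numCycles_threadGraph 1 (fun z p hp => ncard_threads_of_eq hc hp) fun F hF => ?_
  obtain ⟨a, rfl⟩ := Finset.card_eq_one.1 hF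
  obtain ⟨q, hq, ha, -⟩ := exists_isPath_inl_inr (s := s) (e := s) (c := c) a
  have hadj : (threadGraph ι c s s).Adj (.inr (a, Fin.last c)) (.inl s) := Or.inr ⟨rfl, rfl⟩
  refine ⟨_, cons hadj q, (cons_isCycle_iff _ _).2 ⟨hq, fun h => ?_⟩, ?_⟩
  · have hq_eq := hq.eq_adj_toWalk_of_mem_edges (Sym2.eq_swap ▸ h)
    have hlast : 0 = Fin.last c := by simpa [hq_eq] using ha
    exact hc (congrArg Fin.val hlast).symm
  · simp [threads, ha]

end ThreadGraph

section LowerBounds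

variable {L : Set ℕ} {k : ℕ}

theorem div_le_maxCycles (hk : 1 ≤ k) (hL : 2 * k + 1 ∈ L) (n : ℕ) :
    (n - 1) / (2 * k) ≤ maxCycles L n := by
  rcases Nat.eq_zero_or_pos n with rfl | hn
  · simp
  obtain ⟨c, hc⟩ : ∃ c, 2 * k = c + 1 := ⟨2 * k - 1, by lia⟩
  rw [hc] at hL ⊢
  have hdiv := Nat.div_mul_le_self (n - 1) (c + 1)
  set t := (n - 1) / (c + 1)
  let s : Fin (n - t * (c + 1)) := ⟨0, by lia⟩
  have hG : IsLCycleGraph L (threadGraph (Fin t) c s s) := by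
    intro v p hp
    rw [length_eq_of_isCycle hp, ncard_threads_of_eq (by lia) hp, Set.pair_eq_singleton,
      Set.ncard_singleton, one_mul, add_comm]
    exact hL
  have hle := card_le_numCycles_threadGraph (ι := Fin t) (s := s) (c := c) (by lia)
  rw [Nat.card_fin] at hle
  refine hle.trans (numCycles_le_maxCycles ?_ hG)
  simp only [Nat.card_sum, Nat.card_prod, Nat.card_fin]
  lia

theorem choose_two_le_maxCycles (hk : 2 ≤ k) (n : ℕ) :
    ((n - 2) / (k - 1)).choose 2 ≤ maxCycles {2 * k} n := by
  rcases Nat.lt_or_ge n 2 with hn | hn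
  · simp [Nat.sub_eq_zero_of_le hn.le]
  obtain ⟨c, rfl⟩ := Nat.exists_eq_add_of_le' hk
  have hdiv := Nat.div_mul_le_self (n - 2) (c + 1)
  rw [show c + 2 - 1 = c + 1 from rfl]
  set t := (n - 2) / (c + 1)
  let s : Fin (n - t * (c + 1)) := ⟨0, by lia⟩
  let e : Fin (n - t * (c + 1)) := ⟨1, by lia⟩
  have hse : s ≠ e := by simp [s, e]
  have hG : IsLCycleGraph {2 * (c + 2)} (threadGraph (Fin t) c s e) := by
    intro v p hp
    rw [length_eq_of_isCycle hp, ncard_threads_of_ne hp hse, Set.ncard_pair hse,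
      Set.mem_singleton_iff]
    lia
  have hle := choose_two_le_numCycles_threadGraph (ι := Fin t) (c := c) hse
  rw [Nat.card_fin] at hle
  refine hle.trans (numCycles_le_maxCycles ?_ hG)
  simp only [Nat.card_sum, Nat.card_prod, Nat.card_fin]
  lia

end LowerBounds

end LCycleGraph

theorem corollary2 :
    (∀ (L : Set ℕ) (k : ℕ), 1 ≤ k → (∀ m ∈ L, Odd m) → IsLeast L (2 * k + 1) →
        ∀ n : ℕ, maxCycles L n = (n - 1) / (2 * k)) ∧
    (∀ k : ℕ, 1 ≤ k → ∀ n : ℕ, maxCycles {2 * k + 1} n = (n - 1) / (2 * k)) ∧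
    (∀ k : ℕ, 2 ≤ k → ∀ n : ℕ, maxCycles {2 * k} n = ((n - 2) / (k - 1)).choose 2) := by
  have hodd : ∀ (L : Set ℕ) (k : ℕ), 1 ≤ k → (∀ m ∈ L, Odd m) → IsLeast L (2 * k + 1) →
      ∀ n : ℕ, maxCycles L n = (n - 1) / (2 * k) := fun L k hk hL hmin n =>
    le_antisymm (LCycleGraph.maxCycles_le_of_forall_odd hk hL (fun m hm => hmin.2 hm) n)
      (LCycleGraph.div_le_maxCycles hk hmin.1 n)
  refine ⟨hodd, fun k hk n => hodd _ k hk ?_ isLeast_singleton n, fun k hk n => ?_⟩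
  · rintro m rfl
    exact ⟨k, rfl⟩
  · exact le_antisymm (LCycleGraph.maxCycles_le_choose_two hk n)
      (LCycleGraph.choose_two_le_maxCycles hk n)
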